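/- **Lemma 8.1.** Let $0<h\le 1$. Let $\Psi\mathrm D_h(S^1)$ be the space of formal Laurent series $F=\sum_{k\in\mathbb Z}F_k(x)\xi^k$ with $F_k\in C^\infty(S^1)=C^\infty(\mathbb R/2\pi\mathbb Z,\mathbb C)$ and $F_k=0$ for all large $k$, with the product $$F\circ_h G=\sum_{k\ge 0}\frac{h^k}{k!}\,{:}\,\partial_\xi^kF\;\partial_x^kG\,{:}\qquad\bigl({:}f\xi^k\,g\xi^\ell{:}\,=fg\,\xi^{k+\ell}\bigr)$$ and the Lie bracket $\frac1h(F\circ_hG-G\circ_hF)$. Let $\pi(f\partial)=f\xi$ be the standard embedding of $\mathrm{Vect}(S^1)=\{f\partial: f\in C^\infty(S^1)\}$, $[f\partial,g\partial]=(fg'-f'g)\partial$. For $c=(c_0,c_1,c_2,c_3)\in\mathbb C^4$ consider the infinitesimal deformation $$\pi^{\mathrm{inf}}_c(f\partial)=f\xi+c_0\theta_0(f\partial)+c_1\theta_1(f\partial)+c_2\theta_2(f\partial)+c_3\theta_3(f\partial),$$ where $\theta_0(f\partial)=f$, $\theta_1(f\partial)=f'$ and $$\theta_2(f\partial)=\sum_{n\ge2}(-1)^{n-1}\frac{2(n-3)}{n}h^{n-2}f^{(n)}\xi^{-n+1},\qquad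 \theta_3(f\partial)=\sum_{n\ge2}(-1)^{n}\frac{3(n-1)}{n+1}h^{n-2}f^{(n+1)}\xi^{-n}.$$ For $\lambda,\mu,\nu\in\mathbb C$ put $$\widetilde\pi_{\lambda,\mu,\nu}(f\partial)=\Psi_\mu(f\xi+\nu f+\lambda f'),\qquad \Psi_\mu(F)=\xi^\mu\circ_hF\circ_h\xi^{-\mu},$$ the compositions with $\xi^{\pm\mu}$ being computed by the same formula for $\circ_h$. Then: 1. $\widetilde\pi_{\lambda,\mu,\nu}$ is a polynomial deformation of $\pi$ with parameters $(\lambda,\mu,\nu)\in\mathbb C^3$: each $\widetilde\pi_{\lambda,\mu,\nu}$ is a homomorphism of Lie algebras; $\widetilde\pi_{0,0,0}=\pi$; the coefficient of each power $\xi^k$ in $\widetilde\pi_{\lambda,\mu,\nu}-\pi$ is a polynomial in $(\lambda,\mu,\nu)$ whose coefficients are linear maps $\mathrm{Vect}(S^1)\to C^\infty(S^1)$; and it vanishes for all sufficiently large $k$, uniformly in the parameters. 2. Every infinitesimal deformation $\pi^{\mathrm{inf}}_c$ whose parameters satisfy $$\begin{aligned}&6c_1^3c_3-3c_1^2c_2^2-18c_1c_2c_3+8c_2^3+9c_3^2+h\,(3c_1^3c_2-6c_1c_2^2-9c_1^2c_3+18c_2c_3)\\&\quad+h^2(3c_1c_3-5c_1^2c_2+8c_2^2)+2h^3c_1c_2=0\end{aligned}$$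 is the infinitesimal part of $\widetilde\pi_{\lambda,\mu,\nu}$ for some $\lambda,\mu,\nu\in\mathbb C$, in the following sense. There are polynomials $R_n\in\mathbb C[z_1,z_2,z_3]$, $n\ge4$, independent of $c$ and without terms of degree less than $2$, such that for every $c\in\mathbb C^4$ satisfying this relation there are $\lambda,\mu,\nu\in\mathbb C$ with, for all $f\in C^\infty(S^1)$, $$\widetilde\pi_{\lambda,\mu,\nu}(f\partial)=\pi^{\mathrm{inf}}_c(f\partial)+\sum_{n\ge4}R_n(c_1,c_2,c_3)\,f^{(n)}\xi^{1-n}+\nu\,\bigl(\Psi_\mu(f)-f\bigr).$$ (The last two terms are the terms of higher degree in the parameters: every term of $\nu(\Psi_\mu(f)-f)=\nu\sum_{n\ge1}\binom{\mu}{n}h^nf^{(n)}\xi^{-n}$ is divisible by $\mu\nu$. In particular $c_0,c_1,c_2,c_3$ are the coefficients of $f$, $f'$, $f''\xi^{-1}$, $f'''\xi^{-2}$ in $\widetilde\pi_{\lambda,\mu,\nu}(f\partial)$.) -/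

import Mathlib

open scoped ContDiff

noncomputable section

namespace PsiDO

/-- `C^∞(S¹)`: smooth complex-valued functions on the circle `ℝ/2πℤ`, that is, smooth
`2π`-periodic functions of the real coordinate `x`. -/
def SmoothCircle : Subalgebra ℂ (ℝ → ℂ) where
  carrier := {f | ContDiff ℝ ∞ f ∧ Function.Periodic f (2 * Real.pi)}
  mul_mem' := fun ha hb => ⟨ha.1.mul hb.1, ha.2.mul hb.2⟩
  add_mem' := fun ha hb => ⟨ha.1.add hb.1, ha.2.add hb.2⟩
  algebraMap_mem' := fun _ => ⟨contDiff_const, fun _ => rfl⟩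

theorem deriv_mem_smoothCircle (f : SmoothCircle) : deriv (f : ℝ → ℂ) ∈ SmoothCircle := by
  refine ⟨(contDiff_infty_iff_deriv.1 f.2.1).2, fun x => ?_⟩
  have hf : (fun y => (f : ℝ → ℂ) (y + 2 * Real.pi)) = f := funext f.2.2
  rw [← deriv_comp_add_const, hf]

/-- The derivative `f ↦ f' = df/dx` on `C^∞(S¹)`. -/
def D : SmoothCircle →ₗ[ℂ] SmoothCircle where
  toFun f := ⟨deriv (f : ℝ → ℂ), deriv_mem_smoothCircle f⟩
  map_add' f g := by
    ext x
    exact deriv_add ((f.2.1.differentiable (by simp)) x) ((g.2.1.differentiable (by simp)) x)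
  map_smul' c f := by
    ext x
    exact deriv_const_smul c ((f.2.1.differentiable (by simp)) x)

/-- `Vect(S¹)`: the vector field `f(x)∂` is represented by its coefficient `f`
(complex coefficients are allowed). -/
abbrev Vect : Type := SmoothCircle

/-- The Lie bracket of vector fields, `[f∂, g∂] = (f g' - f' g)∂`. -/
def vectBracket (f g : Vect) : Vect := f * D g - D f * g

/-- The underlying space of `ΨD(S¹)`: formal Laurent series `F = ∑_{k ∈ ℤ} F_k(x) ξ^k` with
`F_k ∈ C^∞(S¹)` and `F_k = 0` for all sufficiently large `k`. -/
def PsiD : Submodule ℂ (ℤ → SmoothCircle) where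
  carrier := {F | ∃ N : ℤ, ∀ k, N < k → F k = 0}
  add_mem' := by
    rintro F G ⟨N, hN⟩ ⟨M, hM⟩
    refine ⟨max N M, fun k hk => ?_⟩
    simp [hN k (lt_of_le_of_lt (le_max_left _ _) hk), hM k (lt_of_le_of_lt (le_max_right _ _) hk)]
  zero_mem' := ⟨0, fun _ _ => rfl⟩
  smul_mem' := by
    rintro c F ⟨N, hN⟩
    exact ⟨N, fun k hk => by simp [hN k hk]⟩

/-- The monomial symbol `f(x) ξ^k`. -/
def mono (k : ℤ) (f : SmoothCircle) : PsiD :=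
  ⟨Pi.single k f, k, fun j hj => by simp [(ne_of_gt hj : j ≠ k)]⟩

/-- `(a, F)` stands for the symbol `∑_k F_k(x) ξ^(a+k)` with exponents in `a + ℤ`, `a ∈ ℂ`.
Elements of `ΨD(S¹)` are those with `a = 0`. -/
structure TwistedSymbol where
  exponent : ℂ
  symbol : PsiD

/-- The coefficients of the composition `A ∘_h B = ∑_{k ≥ 0} (h^k / k!) :∂_ξ^k A ∂_x^k B:`, where
`∂_ξ^k ξ^s = s (s-1) ⋯ (s-k+1) ξ^(s-k)`. The summand at `(i, k)` is the contribution of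
the term `ξ^(a+i)` of `A` and the term `ξ^(b+j)` of `B`, `j = m - i + k`, to `ξ^(a+b+m)`. For each
`m` only finitely many summands are nonzero. For `h = 1` this is the usual product; in general it
is the product of the usual one under `f ξ^k ↦ h^k f ξ^k`. -/
def compCoeff (h : ℝ) (A B : TwistedSymbol) (m : ℤ) : SmoothCircle :=
  ∑ᶠ p : ℤ × ℕ,
    ((h : ℂ) ^ p.2 / (p.2.factorial : ℂ) *
        ∏ j ∈ Finset.range p.2, (A.exponent + (p.1 : ℂ) - (j : ℂ))) •
      ((A.symbol : ℤ → SmoothCircle) p.1 *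
        (D ^ p.2) ((B.symbol : ℤ → SmoothCircle) (m - p.1 + (p.2 : ℤ))))

theorem compCoeff_mem (h : ℝ) (A B : TwistedSymbol) : compCoeff h A B ∈ PsiD := by
  obtain ⟨N, hN⟩ := A.symbol.2
  obtain ⟨M, hM⟩ := B.symbol.2
  refine ⟨N + M, fun m hm => ?_⟩
  refine finsum_eq_zero_of_forall_eq_zero fun p => ?_
  rcases lt_or_ge N p.1 with hp | hp
  · rw [hN p.1 hp, zero_mul, smul_zero]
  · rw [hM (m - p.1 + (p.2 : ℤ)) (by omega), map_zero, mul_zero, smul_zero]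

/-- The composition `A ∘_h B` of symbols with complex exponents. -/
def TwistedSymbol.comp (h : ℝ) (A B : TwistedSymbol) : TwistedSymbol :=
  ⟨A.exponent + B.exponent, ⟨compCoeff h A B, compCoeff_mem h A B⟩⟩

/-- An element of `ΨD(S¹)` as a symbol with integer exponents. -/
def toTwisted (F : PsiD) : TwistedSymbol := ⟨0, F⟩

/-- The symbol `ξ^s`, `s ∈ ℂ`. -/
def xiPow (s : ℂ) : TwistedSymbol := ⟨s, mono 0 1⟩

/-- The product `F ∘_h G` of the algebra `ΨD_h(S¹)`. -/
def psiMul (h : ℝ) (F G : PsiD) : PsiD := ((toTwisted F).comp h (toTwisted G)).symbol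

/-- The Lie bracket `(1/h) (F ∘_h G - G ∘_h F)` of `ΨD_h(S¹)`, normalised so that `f∂ ↦ f ξ` is
a homomorphism (and that it tends to the Poisson bracket as `h → 0`); for `h = 1` it is the
commutator of `ΨD(S¹)`. -/
def psiBracket (h : ℝ) (F G : PsiD) : PsiD := (h : ℂ)⁻¹ • (psiMul h F G - psiMul h G F)

/-- `Ψ_μ(F) = ξ^μ ∘_h F ∘_h ξ^(-μ)`. -/
def Psi (h : ℝ) (μ : ℂ) (F : PsiD) : PsiD :=
  (((xiPow μ).comp h (toTwisted F)).comp h (xiPow (-μ))).symbol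

/-- The composition in the definition of `Psi` has integer exponents, as it should. -/
theorem psi_exponent (h : ℝ) (μ : ℂ) (F : PsiD) :
    (((xiPow μ).comp h (toTwisted F)).comp h (xiPow (-μ))).exponent = 0 := by
  simp [TwistedSymbol.comp, xiPow, toTwisted]

/-- The standard embedding `π(f∂) = f ξ`. -/
def standardEmbedding (f : Vect) : PsiD := mono 1 f

/-- The symbol `∑_{n ≥ 0} a_n f^(n)(x) ξ^(d-n)`. -/
def diffSymbol (d : ℤ) (a : ℕ → ℂ) (f : SmoothCircle) : PsiD :=
  ⟨fun k => if k ≤ d then a (d - k).toNat • (D ^ (d - k).toNat) f else 0,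
    d, fun _ hk => if_neg (not_le.2 hk)⟩

/-- `θ₀(f∂) = f`. -/
def theta0 (f : Vect) : PsiD := mono 0 f

/-- `θ₁(f∂) = f'`. -/
def theta1 (f : Vect) : PsiD := mono 0 (D f)

/-- `θ₂(f∂) = ∑_{n ≥ 2} (-1)^(n-1) (2(n-3)/n) h^(n-2) f^(n) ξ^(-n+1) = f'' ξ⁻¹ + ⋯`. -/
def theta2 (h : ℝ) (f : Vect) : PsiD :=
  diffSymbol 1
    (fun n => if 2 ≤ n then
      (-1) ^ (n - 1) * (2 * ((n : ℂ) - 3) / (n : ℂ)) * (h : ℂ) ^ (n - 2) else 0) f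

/-- `θ₃(f∂) = ∑_{n ≥ 2} (-1)^n (3(n-1)/(n+1)) h^(n-2) f^(n+1) ξ^(-n) = f''' ξ⁻² + ⋯`. -/
def theta3 (h : ℝ) (f : Vect) : PsiD :=
  diffSymbol 0
    (fun n => if 2 ≤ n then
      (-1) ^ n * (3 * ((n : ℂ) - 1) / ((n : ℂ) + 1)) * (h : ℂ) ^ (n - 2) else 0) (D f)

/-- The infinitesimal deformation
`f∂ ↦ f ξ + c₀ θ₀(f∂) + c₁ θ₁(f∂) + c₂ θ₂(f∂) + c₃ θ₃(f∂)`. -/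
def infinitesimalDeformation (h : ℝ) (c₀ c₁ c₂ c₃ : ℂ) (f : Vect) : PsiD :=
  standardEmbedding f + c₀ • theta0 f + c₁ • theta1 f + c₂ • theta2 h f + c₃ • theta3 h f

/-- The quartic relation on the parameters, homogeneous of weight `6` for
`weight c_i = i`, `weight h = 1`. -/
def HQuartic (h : ℝ) (c₁ c₂ c₃ : ℂ) : Prop :=
  6 * c₁ ^ 3 * c₃ - 3 * c₁ ^ 2 * c₂ ^ 2 - 18 * c₁ * c₂ * c₃ + 8 * c₂ ^ 3 + 9 * c₃ ^ 2
    + (h : ℂ) * (3 * c₁ ^ 3 * c₂ - 6 * c₁ * c₂ ^ 2 - 9 * c₁ ^ 2 * c₃ + 18 * c₂ * c₃)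
    + (h : ℂ) ^ 2 * (3 * c₁ * c₃ - 5 * c₁ ^ 2 * c₂ + 8 * c₂ ^ 2)
    + (h : ℂ) ^ 3 * (2 * c₁ * c₂) = 0

/-- `π̃_{λ,μ,ν}(f∂) = Ψ_μ(f ξ + ν f + λ f')`. -/
def universalDeformation (h : ℝ) (lam μ ν : ℂ) (f : Vect) : PsiD :=
  Psi h μ (mono 1 f + ν • mono 0 f + lam • mono 0 (D f))

/-- `T` is a polynomial deformation, with parameters in `ℂⁿ`, of the standard embedding
`π : Vect(S¹) → ΨD_h(S¹)`: one has `T(c) = π + ∑_k T_k(c) ξ^k` where every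
`T_k(c) : Vect(S¹) → C^∞(S¹)` is linear and depends polynomially on `c`
(`T_k(c) = ∑_α c^α A_α`, a finite sum with linear maps `A_α`), `T_k(0) = 0`, `T_k ≡ 0` for all
sufficiently large `k`, and every `T(c)` is a homomorphism of Lie algebras. -/
def IsPolynomialDeformation {n : ℕ} (h : ℝ) (T : (Fin n → ℂ) → Vect → PsiD) : Prop :=
  (∀ k : ℤ, ∃ A : (Fin n →₀ ℕ) →₀ (Vect →ₗ[ℂ] SmoothCircle), ∀ c f,
    (T c f : ℤ → SmoothCircle) k - (standardEmbedding f : ℤ → SmoothCircle) k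
      = A.sum fun α L => (∏ i, c i ^ α i) • L f) ∧
  (∀ f, T 0 f = standardEmbedding f) ∧
  (∃ N : ℤ, ∀ k, N < k → ∀ c f,
    (T c f : ℤ → SmoothCircle) k = (standardEmbedding f : ℤ → SmoothCircle) k) ∧
  (∀ c f g, T c (vectBracket f g) = psiBracket h (T c f) (T c g))

end PsiDO

end

open PsiDO

noncomputable section

namespace PsiDO

/-! ### Symbol calculus: composition and conjugation by `ξ^μ`. -/

section

/-! Conjugation by `ξ^μ` respects `∘_h`. On monomials it is an explicit binomial series
(`Psi_mono`), and its multiplicativity is needed only when the left factor has order 0 or 1, where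
it reduces to the Chu–Vandermonde and Pascal identities (`psiMul_binomialSymbol_zero`,
`psiMul_binomialSymbol_one`). The homomorphism property then reduces to that of `f∂ ↦ f ξ + ν f + λ
f'`, and polynomial dependence is visible in the binomial coefficients.

For the second claim, write `Ψ_μ(f ξ + λ f') = ∑ a_n f^(n) ξ^(1-n)`. The map `(λ, μ) ↦ (a_1, a_2,
a_3)` parametrises the quartic surface: eliminating `μ` from the equations `a_i = c_i` gives a monic
quadratic and a linear equation, whose resultant is four times the quartic
(`HQuartic.exists_densityCoeff`).

The map identifies `(0, μ+1)` with `(h, μ)`, since `f ξ + h f' = ξ ∘_h f`. Each `a_n` takes equal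
values at identified points, and this suffices to make it a polynomial in `a_1`, `a_2`, `a_3`
(`exists_densityCoeff_eq_eval`). The origin has the two preimages `(0, 0)` and `(h, -1)`; curves
through them have three independent tangent directions, so they determine the linear part of that
polynomial (`coeff_of_densityCoeff_eq_eval`). It consists of the coefficients of `θ₂` and `θ₃`; the
rest is `R_n`. The parameter `ν` is simply `c₀`. -/

theorem PsiD.ext_apply {F G : PsiD}
    (h : ∀ k, (F : ℤ → SmoothCircle) k = (G : ℤ → SmoothCircle) k) : F = G :=
  Subtype.ext (funext h)

/-- Two symbols that vanish above order `d` agree if their coefficients of `ξ^(d-n)`,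
`n ∈ ℕ`, agree. -/
theorem PsiD.ext_below {F G : PsiD} (d : ℤ)
    (hF : ∀ k, d < k → (F : ℤ → SmoothCircle) k = 0)
    (hG : ∀ k, d < k → (G : ℤ → SmoothCircle) k = 0)
    (h : ∀ n : ℕ, (F : ℤ → SmoothCircle) (d - n) = (G : ℤ → SmoothCircle) (d - n)) : F = G := by
  refine PsiD.ext_apply fun k => ?_
  rcases lt_or_ge d k with hk | hk
  · rw [hF k hk, hG k hk]
  · obtain ⟨n, hn⟩ := Int.eq_ofNat_of_zero_le (sub_nonneg.2 hk)
    obtain rfl : k = d - n := by omega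
    exact h n

/-! ### Derivatives -/

theorem D_mul (f g : SmoothCircle) : D (f * g) = D f * g + f * D g := by
  ext x
  exact deriv_mul ((f.2.1.differentiable (by simp)) x) ((g.2.1.differentiable (by simp)) x)

theorem D_one : D 1 = 0 := by
  ext x
  exact deriv_const x (1 : ℂ)

theorem D_pow_one {k : ℕ} (hk : k ≠ 0) : (D ^ k) 1 = 0 := by
  obtain ⟨k, rfl⟩ := Nat.exists_eq_succ_of_ne_zero hk
  rw [Nat.succ_eq_add_one, pow_succ, Module.End.mul_apply, D_one, map_zero]

/-- The general Leibniz rule. -/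
theorem D_pow_mul (n : ℕ) (f g : SmoothCircle) :
    (D ^ n) (f * g) =
      ∑ ij ∈ Finset.HasAntidiagonal.antidiagonal n, n.choose ij.1 • ((D ^ ij.1) f * (D ^ ij.2) g) := by
  induction n with
  | zero => simp
  | succ n ih =>
    rw [Finset.sum_antidiagonal_choose_succ_nsmul (fun i j => (D ^ i) f * (D ^ j) g) n]
    simp only [pow_succ' D, Module.End.mul_apply, ih, map_sum, map_nsmul, D_mul, smul_add,
      Finset.sum_add_distrib]
    rw [add_comm]
    refine congrArg₂ (· + ·) rfl (Finset.sum_congr rfl fun ij hij => ?_)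
    rw [n.choose_symm_of_eq_add (Finset.HasAntidiagonal.mem_antidiagonal.1 hij).symm]

/-! ### Coefficients of symbols -/

theorem diffSymbol_apply_sub (d : ℤ) (a : ℕ → ℂ) (f : SmoothCircle) (n : ℕ) :
    (diffSymbol d a f : ℤ → SmoothCircle) (d - n) = a n • (D ^ n) f := by
  simp [diffSymbol]

theorem diffSymbol_apply_of_lt {d k : ℤ} (hk : d < k) (a : ℕ → ℂ) (f : SmoothCircle) :
    (diffSymbol d a f : ℤ → SmoothCircle) k = 0 :=
  if_neg (not_le.2 hk)

theorem diffSymbol_add (d : ℤ) (a : ℕ → ℂ) (f g : SmoothCircle) :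
    diffSymbol d a (f + g) = diffSymbol d a f + diffSymbol d a g := by
  refine PsiD.ext_apply fun k => ?_
  simp only [diffSymbol, Submodule.coe_add, Pi.add_apply]
  split_ifs <;> simp

theorem diffSymbol_sub (d : ℤ) (a : ℕ → ℂ) (f g : SmoothCircle) :
    diffSymbol d a (f - g) = diffSymbol d a f - diffSymbol d a g := by
  refine PsiD.ext_apply fun k => ?_
  simp only [diffSymbol, Submodule.coe_sub, Pi.sub_apply]
  split_ifs <;> simp [smul_sub]

theorem mono_apply (k j : ℤ) (f : SmoothCircle) :
    (mono k f : ℤ → SmoothCircle) j = if j = k then f else 0 := by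
  simp [mono, Pi.single_apply]

/-! ### Bilinearity of the composition -/

/-- The order bounds on both factors confine `(i, k)` to a box. Additivity depends on this, because
`finsum` has the value zero on infinite support. -/
theorem compCoeff_support_finite (c : ℤ × ℕ → ℂ) (F G : PsiD) (m : ℤ) :
    (Function.support fun p : ℤ × ℕ => c p • ((F : ℤ → SmoothCircle) p.1 *
      (D ^ p.2) ((G : ℤ → SmoothCircle) (m - p.1 + (p.2 : ℤ))))).Finite := by
  obtain ⟨N, hN⟩ := F.2
  obtain ⟨M, hM⟩ := G.2
  refine (Finset.finite_toSet
    (Finset.Icc (m - M) N ×ˢ Finset.range ((M + N - m).toNat + 1))).subset fun p hp => ?_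
  rw [Function.mem_support] at hp
  have h1 : p.1 ≤ N := by
    by_contra! hlt
    exact hp (by rw [hN _ hlt, zero_mul, smul_zero])
  have h2 : m - p.1 + (p.2 : ℤ) ≤ M := by
    by_contra! hlt
    exact hp (by rw [hM _ hlt, map_zero, mul_zero, smul_zero])
  simp only [Finset.coe_product, Finset.coe_Icc, Set.mem_prod, Set.mem_Icc, Finset.coe_range,
    Set.mem_Iio]
  omega

variable (h : ℝ) (s t : ℂ)

theorem compCoeff_add_left (F F' G : PsiD) (m : ℤ) :
    compCoeff h ⟨s, F + F'⟩ ⟨t, G⟩ m =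
      compCoeff h ⟨s, F⟩ ⟨t, G⟩ m + compCoeff h ⟨s, F'⟩ ⟨t, G⟩ m := by
  simp only [compCoeff]
  rw [← finsum_add_distrib (compCoeff_support_finite _ _ _ _) (compCoeff_support_finite _ _ _ _)]
  exact finsum_congr fun p => by
    rw [Submodule.coe_add, Pi.add_apply, add_mul, smul_add]

theorem compCoeff_add_right (F G G' : PsiD) (m : ℤ) :
    compCoeff h ⟨s, F⟩ ⟨t, G + G'⟩ m =
      compCoeff h ⟨s, F⟩ ⟨t, G⟩ m + compCoeff h ⟨s, F⟩ ⟨t, G'⟩ m := by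
  simp only [compCoeff]
  rw [← finsum_add_distrib (compCoeff_support_finite _ _ _ _) (compCoeff_support_finite _ _ _ _)]
  exact finsum_congr fun p => by
    rw [Submodule.coe_add, Pi.add_apply, map_add, mul_add, smul_add]

theorem compCoeff_smul_left (c : ℂ) (F G : PsiD) (m : ℤ) :
    compCoeff h ⟨s, c • F⟩ ⟨t, G⟩ m = c • compCoeff h ⟨s, F⟩ ⟨t, G⟩ m := by
  simp only [compCoeff]
  rw [smul_finsum' c (compCoeff_support_finite _ _ _ _)]
  exact finsum_congr fun p => by
    rw [Submodule.coe_smul, Pi.smul_apply, smul_mul_assoc, smul_comm]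

theorem compCoeff_smul_right (c : ℂ) (F G : PsiD) (m : ℤ) :
    compCoeff h ⟨s, F⟩ ⟨t, c • G⟩ m = c • compCoeff h ⟨s, F⟩ ⟨t, G⟩ m := by
  simp only [compCoeff]
  rw [smul_finsum' c (compCoeff_support_finite _ _ _ _)]
  exact finsum_congr fun p => by
    rw [Submodule.coe_smul, Pi.smul_apply, map_smul, mul_smul_comm, smul_comm]

/-- The product `∘_h` as a bilinear map. -/
def psiMulBilin : PsiD →ₗ[ℂ] PsiD →ₗ[ℂ] PsiD :=
  LinearMap.mk₂ ℂ (psiMul h)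
    (fun F F' G => PsiD.ext_apply fun m => compCoeff_add_left h 0 0 F F' G m)
    (fun c F G => PsiD.ext_apply fun m => compCoeff_smul_left h 0 0 c F G m)
    (fun F G G' => PsiD.ext_apply fun m => compCoeff_add_right h 0 0 F G G' m)
    (fun c F G => PsiD.ext_apply fun m => compCoeff_smul_right h 0 0 c F G m)

theorem psiMulBilin_apply (F G : PsiD) : psiMulBilin h F G = psiMul h F G := rfl

/-! ### Conjugation by `ξ^μ` -/

/-- Gives access to the Vandermonde and Pascal identities for `Ring.choose` at complex arguments. -/
theorem prod_sub_div_factorial (x : ℂ) (n : ℕ) :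
    (∏ j ∈ Finset.range n, (x - (j : ℂ))) / (n.factorial : ℂ) = Ring.choose x n := by
  have key : ∏ j ∈ Finset.range n, (x - (j : ℂ)) = (descPochhammer ℤ n).smeval x := by
    induction n with
    | zero => simp
    | succ n ih =>
      rw [Finset.prod_range_succ, ih, descPochhammer_succ_right, Polynomial.smeval_mul,
        Polynomial.smeval_sub, Polynomial.smeval_X, Polynomial.smeval_natCast]
      simp
  rw [Ring.choose_eq_smul, key, smul_eq_mul, div_eq_inv_mul]

theorem pow_div_factorial_mul_prod (x : ℂ) (n : ℕ) :
    (h : ℂ) ^ n / (n.factorial : ℂ) * ∏ j ∈ Finset.range n, (x - (j : ℂ)) =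
      Ring.choose x n * (h : ℂ) ^ n := by
  rw [← prod_sub_div_factorial]; ring

/-- The coefficient of `ξ^t` is constant, so every summand with a positive number of `x`-derivatives
vanishes. Hence the right factor `ξ^(-μ)` in `Psi` only shifts exponents. -/
theorem compCoeff_xiPow_right (A : TwistedSymbol) (m : ℤ) :
    compCoeff h A (xiPow t) m = (A.symbol : ℤ → SmoothCircle) m := by
  rw [compCoeff, finsum_eq_single _ (m, 0)]
  · simp [xiPow, mono_apply]
  · rintro ⟨i, k⟩ hp
    simp only [xiPow, mono_apply]
    split_ifs with hik
    · have hk : k ≠ 0 := by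
        rintro rfl
        exact hp (Prod.ext (by simp at hik ⊢; omega) rfl)
      rw [D_pow_one hk, mul_zero, smul_zero]
    · rw [map_zero, mul_zero, smul_zero]

theorem Psi_apply (μ : ℂ) (F : PsiD) (m : ℤ) :
    (Psi h μ F : ℤ → SmoothCircle) m = compCoeff h (xiPow μ) (toTwisted F) m :=
  compCoeff_xiPow_right h (-μ) _ m

theorem Psi_add (μ : ℂ) (F G : PsiD) : Psi h μ (F + G) = Psi h μ F + Psi h μ G :=
  PsiD.ext_apply fun m => by
    rw [Submodule.coe_add, Pi.add_apply, Psi_apply, Psi_apply, Psi_apply]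
    exact compCoeff_add_right h μ 0 _ F G m

theorem Psi_smul (μ c : ℂ) (F : PsiD) : Psi h μ (c • F) = c • Psi h μ F :=
  PsiD.ext_apply fun m => by
    rw [Submodule.coe_smul, Pi.smul_apply, Psi_apply, Psi_apply]
    exact compCoeff_smul_right h μ 0 c _ F m

/-- The symbol `∑_n h^n (μ choose n) f^(n) ξ^(d-n)`. -/
def binomialSymbol (μ : ℂ) (d : ℤ) (f : SmoothCircle) : PsiD :=
  diffSymbol d (fun n => Ring.choose μ n * (h : ℂ) ^ n) f

theorem Psi_mono (μ : ℂ) (d : ℤ) (f : SmoothCircle) :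
    Psi h μ (mono d f) = binomialSymbol h μ d f := by
  refine PsiD.ext_below d (fun k hk => ?_) (fun k hk => diffSymbol_apply_of_lt hk _ _)
    fun n => ?_
  · rw [Psi_apply, compCoeff]
    refine finsum_eq_zero_of_forall_eq_zero fun p => ?_
    simp only [xiPow, toTwisted, mono_apply]
    rcases eq_or_ne p.1 0 with hp | hp
    · rw [if_neg (by omega : ¬ k - p.1 + (p.2 : ℤ) = d), map_zero, mul_zero, smul_zero]
    · rw [if_neg hp, zero_mul, smul_zero]
  · rw [Psi_apply, compCoeff, finsum_eq_single _ (0, n), binomialSymbol, diffSymbol_apply_sub]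
    · simp [xiPow, toTwisted, mono_apply, ← pow_div_factorial_mul_prod]
    · rintro ⟨i, k⟩ hp
      simp only [xiPow, toTwisted, mono_apply]
      rcases eq_or_ne i 0 with rfl | hi
      · have hk : k ≠ n := fun hk => hp (by rw [hk])
        rw [if_neg (by omega : ¬ d - (n : ℤ) - 0 + (k : ℤ) = d), map_zero, mul_zero, smul_zero]
      · rw [if_neg hi, zero_mul, smul_zero]

/-! ### Products of symbols of differential type -/

theorem psiMul_diffSymbol_of_lt {i j m : ℤ} (hm : i + j < m) (a b : ℕ → ℂ) (f g : SmoothCircle) :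
    (psiMul h (diffSymbol i a f) (diffSymbol j b g) : ℤ → SmoothCircle) m = 0 := by
  refine finsum_eq_zero_of_forall_eq_zero fun p => ?_
  simp only [toTwisted]
  rcases lt_or_ge i p.1 with hp | hp
  · rw [diffSymbol_apply_of_lt hp, zero_mul, smul_zero]
  · rw [diffSymbol_apply_of_lt (by omega : j < m - p.1 + (p.2 : ℤ)), map_zero, mul_zero,
      smul_zero]

theorem psiMul_diffSymbol_sub (i j : ℤ) (a b : ℕ → ℂ) (f g : SmoothCircle) (r : ℕ) :
    (psiMul h (diffSymbol i a f) (diffSymbol j b g) : ℤ → SmoothCircle) (i + j - r) =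
      ∑ x ∈ Finset.range (r + 1), ∑ k ∈ Finset.range (r - x + 1),
        (Ring.choose ((i : ℂ) - x) k * (h : ℂ) ^ k * a x * b (r - x - k)) •
          ((D ^ x) f * (D ^ (r - x)) g) := by
  -- The pair `(x, k)` selects the term `ξ^(i-x)` on the left and the `k`-th `ξ`-derivative; the
  -- remaining drop in order, `r - x - k`, falls on the right factor.
  have hinj : Function.Injective
      fun q : (_ : ℕ) × ℕ => ((i - (q.1 : ℤ), q.2) : ℤ × ℕ) := by
    rintro ⟨x, k⟩ ⟨y, l⟩ hxy
    simp only [Prod.mk.injEq] at hxy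
    obtain ⟨h1, rfl⟩ := hxy
    obtain rfl : x = y := by omega
    rfl
  change compCoeff h _ _ _ = _
  rw [compCoeff, finsum_eq_sum_of_support_subset (s := Finset.image
    (fun q : (_ : ℕ) × ℕ => ((i - (q.1 : ℤ), q.2) : ℤ × ℕ))
    ((Finset.range (r + 1)).sigma fun x => Finset.range (r - x + 1))),
    Finset.sum_image hinj.injOn, Finset.sum_sigma]
  · refine Finset.sum_congr rfl fun x hx => Finset.sum_congr rfl fun k hk => ?_
    rw [Finset.mem_range] at hx hk
    have hidx : i + j - (r : ℤ) - (i - (x : ℤ)) + (k : ℤ) = j - ((r - x - k : ℕ) : ℤ) := by omega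
    have hD : (D ^ k) ((D ^ (r - x - k)) g) = (D ^ (r - x)) g := by
      rw [← Module.End.mul_apply, ← pow_add]
      congr 2; omega
    simp only [toTwisted]
    rw [hidx, diffSymbol_apply_sub, diffSymbol_apply_sub, map_smul, hD, pow_div_factorial_mul_prod,
      smul_mul_smul_comm, smul_smul, zero_add]
    push_cast
    congr 1; ring
  · rintro ⟨l, k⟩ hp
    rw [Function.mem_support] at hp
    simp only [toTwisted] at hp
    have h1 : l ≤ i := by
      by_contra! hlt
      exact hp (by rw [diffSymbol_apply_of_lt hlt, zero_mul, smul_zero])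
    have h2 : i + j - (r : ℤ) - l + (k : ℤ) ≤ j := by
      by_contra! hlt
      exact hp (by rw [diffSymbol_apply_of_lt hlt, map_zero, mul_zero, smul_zero])
    rw [Finset.mem_coe, Finset.mem_image]
    refine ⟨⟨(i - l).toNat, k⟩, ?_, Prod.ext (by simp; omega) rfl⟩
    simp only [Finset.mem_sigma, Finset.mem_range]
    omega

/-- For fixed `x` the sum over `k` of `(i-x choose k) (μ choose r-x-k)` is evaluated by
Chu–Vandermonde. -/
theorem psiMul_binomialSymbol_sub (μ : ℂ) (i j : ℤ) (f g : SmoothCircle) (r : ℕ) :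
    (psiMul h (binomialSymbol h μ i f) (binomialSymbol h μ j g) : ℤ → SmoothCircle) (i + j - r) =
      ∑ x ∈ Finset.range (r + 1),
        (Ring.choose μ x * Ring.choose (μ + i - x) (r - x) * (h : ℂ) ^ r) •
          ((D ^ x) f * (D ^ (r - x)) g) := by
  rw [binomialSymbol, binomialSymbol, psiMul_diffSymbol_sub]
  refine Finset.sum_congr rfl fun x hx => ?_
  rw [← Finset.sum_smul]
  congr 1
  rw [show μ + (i : ℂ) - x = ((i : ℂ) - x) + μ by ring, Ring.add_choose_eq _ (Commute.all _ _),
    Finset.Nat.sum_antidiagonal_eq_sum_range_succ_mk, Finset.mul_sum, Finset.sum_mul]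
  refine Finset.sum_congr rfl fun k hk => ?_
  rw [Finset.mem_range] at hx hk
  have hr : (h : ℂ) ^ r = (h : ℂ) ^ k * (h : ℂ) ^ x * (h : ℂ) ^ (r - x - k) := by
    rw [← pow_add, ← pow_add]; congr 1; omega
  rw [hr]; ring

/-- Leibniz together with `(μ choose r) (r choose x) = (μ choose x) (μ-x choose r-x)`; this has the
form of the previous product formula with `i = 0`. -/
theorem binomialSymbol_mul_sub (μ : ℂ) (d : ℤ) (f g : SmoothCircle) (r : ℕ) :
    (binomialSymbol h μ d (f * g) : ℤ → SmoothCircle) (d - r) =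
      ∑ x ∈ Finset.range (r + 1),
        (Ring.choose μ x * Ring.choose (μ - x) (r - x) * (h : ℂ) ^ r) •
          ((D ^ x) f * (D ^ (r - x)) g) := by
  rw [binomialSymbol, diffSymbol_apply_sub, D_pow_mul,
    Finset.Nat.sum_antidiagonal_eq_sum_range_succ_mk, Finset.smul_sum]
  refine Finset.sum_congr rfl fun x hx => ?_
  rw [Finset.mem_range] at hx
  rw [← Ring.choose_smul_choose μ (by omega : x ≤ r), ← Nat.cast_smul_eq_nsmul ℂ, smul_smul,
    nsmul_eq_mul]
  congr 1; ring

/-- `Ψ_μ(f) ∘_h Ψ_μ(g ξ^j) = Ψ_μ(f g ξ^j)`. -/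
theorem psiMul_binomialSymbol_zero (μ : ℂ) (j : ℤ) (f g : SmoothCircle) :
    psiMul h (binomialSymbol h μ 0 f) (binomialSymbol h μ j g) =
      binomialSymbol h μ j (f * g) := by
  refine PsiD.ext_below (0 + j) (fun k hk => psiMul_diffSymbol_of_lt h hk _ _ _ _)
    (fun k hk => diffSymbol_apply_of_lt (by omega) _ _) fun r => ?_
  rw [psiMul_binomialSymbol_sub, zero_add, binomialSymbol_mul_sub]
  simp

/-- `Ψ_μ(f ξ) ∘_h Ψ_μ(g ξ^j) = Ψ_μ(f g ξ^(j+1) + h f g' ξ^j)`. -/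
theorem psiMul_binomialSymbol_one (μ : ℂ) (j : ℤ) (f g : SmoothCircle) :
    psiMul h (binomialSymbol h μ 1 f) (binomialSymbol h μ j g) =
      binomialSymbol h μ (1 + j) (f * g) + (h : ℂ) • binomialSymbol h μ j (f * D g) := by
  refine PsiD.ext_below (1 + j) (fun k hk => psiMul_diffSymbol_of_lt h hk _ _ _ _)
    (fun k hk => ?_) fun r => ?_
  · rw [Submodule.coe_add, Pi.add_apply, Submodule.coe_smul, Pi.smul_apply, binomialSymbol,
      binomialSymbol, diffSymbol_apply_of_lt hk, diffSymbol_apply_of_lt (by omega), smul_zero,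
      add_zero]
  rw [Submodule.coe_add, Pi.add_apply, Submodule.coe_smul, Pi.smul_apply,
    psiMul_binomialSymbol_sub, binomialSymbol_mul_sub]
  -- The term with `f g'` starts one order lower, so it is absent from the top coefficient.
  obtain _ | r := r
  · have hz : (binomialSymbol h μ j (f * D g) : ℤ → SmoothCircle) (1 + j - ((0 : ℕ) : ℤ)) = 0 :=
      diffSymbol_apply_of_lt (by simp) _ _
    rw [hz, smul_zero, add_zero]
    simp
  · rw [show 1 + j - ((r + 1 : ℕ) : ℤ) = j - r by push_cast; ring, binomialSymbol_mul_sub,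
      Finset.sum_range_succ, Finset.sum_range_succ (n := r + 1), add_right_comm, Finset.smul_sum,
      ← Finset.sum_add_distrib]
    congr 1
    · refine Finset.sum_congr rfl fun x hx => ?_
      rw [Finset.mem_range] at hx
      obtain ⟨y, rfl⟩ := Nat.exists_eq_add_of_le (Nat.lt_succ_iff.1 hx)
      have hy : x + y + 1 - x = y + 1 := by omega
      have hD : (D ^ y) (D g) = (D ^ (y + 1)) g := by rw [pow_succ, Module.End.mul_apply]
      -- Pascal's rule for `(μ-x+1 choose y+1)` splits the coefficient into the contributions of `f
      -- g` and of `f g'`.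
      rw [hy, Nat.add_sub_cancel_left, hD, smul_smul, ← add_smul, Int.cast_one,
        show μ + 1 - (x : ℂ) = (μ - x) + 1 by ring, Ring.choose_succ_succ]
      congr 1; ring
    · simp

end

section

/-! ### The universal deformation -/

variable (h : ℝ)

theorem binomialSymbol_add (μ : ℂ) (d : ℤ) (f g : SmoothCircle) :
    binomialSymbol h μ d (f + g) = binomialSymbol h μ d f + binomialSymbol h μ d g :=
  diffSymbol_add d _ f g

theorem binomialSymbol_sub (μ : ℂ) (d : ℤ) (f g : SmoothCircle) :
    binomialSymbol h μ d (f - g) = binomialSymbol h μ d f - binomialSymbol h μ d g :=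
  diffSymbol_sub d _ f g

theorem universalDeformation_eq (lam μ ν : ℂ) (f : Vect) :
    universalDeformation h lam μ ν f =
      binomialSymbol h μ 1 f + ν • binomialSymbol h μ 0 f +
        lam • binomialSymbol h μ 0 (D f) := by
  simp only [universalDeformation, Psi_add, Psi_smul, Psi_mono]

/-- `π̃_{λ,μ,ν}` is a homomorphism of Lie algebras. -/
theorem universalDeformation_vectBracket (hh : h ≠ 0) (lam μ ν : ℂ) (f g : Vect) :
    universalDeformation h lam μ ν (vectBracket f g) =
      psiBracket h (universalDeformation h lam μ ν f) (universalDeformation h lam μ ν g) := by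
  have hc : (h : ℂ) ≠ 0 := Complex.ofReal_ne_zero.2 hh
  rw [psiBracket, eq_inv_smul_iff₀ hc]
  simp only [universalDeformation_eq, vectBracket, ← psiMulBilin_apply, map_add, map_smul,
    LinearMap.add_apply, LinearMap.smul_apply]
  simp only [psiMulBilin_apply, psiMul_binomialSymbol_zero, psiMul_binomialSymbol_one, map_sub,
    D_mul, binomialSymbol_add, binomialSymbol_sub, mul_comm g, mul_comm (D g) (D f),
    mul_comm (D g) f]
  simp only [add_zero]
  module

/-- Families of maps `Vect(S¹) → C^∞(S¹)` that depend polynomially on parameters in `ℂⁿ`, with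
linear maps as coefficients. -/
def IsPolynomialFamily {n : ℕ} (T : (Fin n → ℂ) → Vect → SmoothCircle) : Prop :=
  ∃ A : (Fin n →₀ ℕ) →₀ (Vect →ₗ[ℂ] SmoothCircle), ∀ c f,
    T c f = A.sum fun α L => (∏ i, c i ^ α i) • L f

theorem IsPolynomialFamily.add {n : ℕ} {T T' : (Fin n → ℂ) → Vect → SmoothCircle}
    (hT : IsPolynomialFamily T) (hT' : IsPolynomialFamily T') :
    IsPolynomialFamily fun c f => T c f + T' c f := by
  obtain ⟨A, hA⟩ := hT
  obtain ⟨B, hB⟩ := hT'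
  refine ⟨A + B, fun c f => ?_⟩
  beta_reduce
  rw [hA, hB, Finsupp.sum_add_index']
  · simp
  · simp [smul_add]

theorem isPolynomialFamily_zero {n : ℕ} :
    IsPolynomialFamily fun (_ : Fin n → ℂ) (_ : Vect) => (0 : SmoothCircle) :=
  ⟨0, fun _ _ => by simp⟩

theorem isPolynomialFamily_eval_smul {n : ℕ} (P : MvPolynomial (Fin n) ℂ)
    (L : Vect →ₗ[ℂ] SmoothCircle) :
    IsPolynomialFamily fun c f => MvPolynomial.eval c P • L f := by
  induction P using MvPolynomial.induction_on' with
  | monomial α a =>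
    refine ⟨Finsupp.single α (a • L), fun c f => ?_⟩
    beta_reduce
    rw [Finsupp.sum_single_index (by simp), MvPolynomial.eval_monomial, LinearMap.smul_apply,
      smul_smul, mul_comm a, Finsupp.prod_fintype _ _ (by simp)]
  | add p q hp hq =>
    simp only [map_add, add_smul]
    exact hp.add hq

/-- The polynomial `h^n (X_i choose n)`. -/
def choosePolynomial {k : ℕ} (i : Fin k) (n : ℕ) : MvPolynomial (Fin k) ℂ :=
  MvPolynomial.C ((h : ℂ) ^ n / (n.factorial : ℂ)) *
    ∏ j ∈ Finset.range n, (MvPolynomial.X i - MvPolynomial.C (j : ℂ))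

theorem eval_choosePolynomial {k : ℕ} (i : Fin k) (n : ℕ) (c : Fin k → ℂ) :
    MvPolynomial.eval c (choosePolynomial h i n) = Ring.choose (c i) n * (h : ℂ) ^ n := by
  simp [choosePolynomial, map_prod, ← pow_div_factorial_mul_prod]

theorem universalDeformation_apply_neg (lam μ ν : ℂ) (f : Vect) (n : ℕ) :
    (universalDeformation h lam μ ν f : ℤ → SmoothCircle) (0 - n) =
      (Ring.choose μ (n + 1) * (h : ℂ) ^ (n + 1) + lam * (Ring.choose μ n * (h : ℂ) ^ n)) •
          (D ^ (n + 1)) f +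
        (ν * (Ring.choose μ n * (h : ℂ) ^ n)) • (D ^ n) f := by
  have h1 := diffSymbol_apply_sub 1 (fun n => Ring.choose μ n * (h : ℂ) ^ n) f (n + 1)
  rw [show (1 : ℤ) - ((n + 1 : ℕ) : ℤ) = 0 - n by push_cast; ring] at h1
  rw [universalDeformation_eq]
  simp only [Submodule.coe_add, Pi.add_apply, Submodule.coe_smul, Pi.smul_apply, binomialSymbol,
    h1, diffSymbol_apply_sub, pow_succ D, Module.End.mul_apply]
  module

theorem universalDeformation_apply_of_pos (lam μ ν : ℂ) (f : Vect) {k : ℤ} (hk : 0 < k) :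
    (universalDeformation h lam μ ν f : ℤ → SmoothCircle) k =
      (standardEmbedding f : ℤ → SmoothCircle) k := by
  rw [universalDeformation_eq, standardEmbedding, mono_apply]
  simp only [Submodule.coe_add, Pi.add_apply, Submodule.coe_smul, Pi.smul_apply, binomialSymbol,
    diffSymbol_apply_of_lt hk, smul_zero, add_zero]
  split_ifs with h1
  · subst h1
    simpa using diffSymbol_apply_sub 1 (fun n => Ring.choose μ n * (h : ℂ) ^ n) f 0
  · exact diffSymbol_apply_of_lt (by omega) _ _

theorem universalDeformation_zero (f : Vect) :
    universalDeformation h 0 0 0 f = standardEmbedding f := by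
  refine PsiD.ext_apply fun k => ?_
  rcases lt_or_ge 0 k with hk | hk
  · exact universalDeformation_apply_of_pos h 0 0 0 f hk
  · obtain ⟨n, hn⟩ := Int.eq_ofNat_of_zero_le (sub_nonneg.2 hk)
    obtain rfl : k = 0 - n := by omega
    rw [universalDeformation_apply_neg, standardEmbedding, mono_apply,
      if_neg (by omega), Ring.choose_zero_succ]
    simp

theorem isPolynomialDeformation_universalDeformation (hh : h ≠ 0) :
    IsPolynomialDeformation h
      (fun p : Fin 3 → ℂ => universalDeformation h (p 0) (p 1) (p 2)) := by
  refine ⟨fun k => ?_, fun f => universalDeformation_zero h f,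
    ⟨0, fun k hk c f => universalDeformation_apply_of_pos h _ _ _ f hk⟩,
    fun c f g => universalDeformation_vectBracket h hh _ _ _ f g⟩
  change IsPolynomialFamily _
  rcases lt_or_ge 0 k with hk | hk
  · simp only [universalDeformation_apply_of_pos h _ _ _ _ hk, sub_self]
    exact isPolynomialFamily_zero
  · obtain ⟨n, hn⟩ := Int.eq_ofNat_of_zero_le (sub_nonneg.2 hk)
    obtain rfl : k = 0 - n := by omega
    have hz : ∀ f : Vect, (standardEmbedding f : ℤ → SmoothCircle) (0 - (n : ℤ)) = 0 := fun f => by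
      rw [standardEmbedding, mono_apply, if_neg (by omega)]
    simp only [hz, sub_zero, universalDeformation_apply_neg]
    convert (isPolynomialFamily_eval_smul (choosePolynomial h 1 (n + 1) +
      MvPolynomial.X 0 * choosePolynomial h 1 n) (D ^ (n + 1))).add
      (isPolynomialFamily_eval_smul (MvPolynomial.X 2 * choosePolynomial h (1 : Fin 3) n) (D ^ n))
      using 4 <;> simp [eval_choosePolynomial]

end

section

/-! ### The coefficients of the deformation as polynomials in the first three of them -/

open Polynomial in
/-- Functions of `(λ, c)` of the form `U(c, k) + V(c, k) λ` with `k = λ² - hλ` and polynomials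
`U`, `V`. -/
def HasNormalForm (h : ℂ) (g : ℂ → ℂ → ℂ) : Prop :=
  ∃ U V : ℂ[X][X], ∀ l c, g l c =
    U.evalEval c (l ^ 2 - h * l) + V.evalEval c (l ^ 2 - h * l) * l

namespace HasNormalForm

variable {h : ℂ} {g g' : ℂ → ℂ → ℂ}

theorem const (a : ℂ) : HasNormalForm h fun _ _ => a :=
  ⟨Polynomial.CC a, 0, fun l c => by simp⟩

theorem fst : HasNormalForm h fun l _ => l :=
  ⟨0, 1, fun l c => by simp⟩

theorem snd : HasNormalForm h fun _ c => c :=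
  ⟨Polynomial.C Polynomial.X, 0, fun l c => by simp [Polynomial.evalEval_C]⟩

theorem add (hg : HasNormalForm h g) (hg' : HasNormalForm h g') :
    HasNormalForm h fun l c => g l c + g' l c := by
  obtain ⟨U, V, hUV⟩ := hg
  obtain ⟨U', V', hUV'⟩ := hg'
  refine ⟨U + U', V + V', fun l c => ?_⟩
  simp only [hUV, hUV', Polynomial.evalEval_add]
  ring

/-- Reduction by `λ² = k + h λ`; the outer variable of `U` and `V` is `k`. -/
theorem mul (hg : HasNormalForm h g) (hg' : HasNormalForm h g') :
    HasNormalForm h fun l c => g l c * g' l c := by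
  obtain ⟨U, V, hUV⟩ := hg
  obtain ⟨U', V', hUV'⟩ := hg'
  refine ⟨U * U' + V * V' * Polynomial.X,
    U * V' + U' * V + Polynomial.CC h * (V * V'), fun l c => ?_⟩
  simp only [hUV, hUV', Polynomial.evalEval_add, Polynomial.evalEval_mul, Polynomial.evalEval_X,
    Polynomial.evalEval_CC]
  ring

theorem choose (hg : HasNormalForm h g) (n : ℕ) :
    HasNormalForm h fun l c => Ring.choose (g l c) n := by
  have hprod : HasNormalForm h fun l c => ∏ j ∈ Finset.range n, (g l c - (j : ℂ)) := by
    induction n with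
    | zero => simpa using const 1
    | succ n ih =>
      simp only [Finset.prod_range_succ, sub_eq_add_neg]
      simp only [sub_eq_add_neg] at ih
      exact ih.mul (hg.add (const _))
  simp only [← prod_sub_div_factorial, div_eq_mul_inv]
  exact hprod.mul (const _)

/-- If the function takes the same values at the two roots `λ = 0`, `λ = h` of `k`, then `V` is
divisible by `k`. -/
theorem exists_of_apply_eq (hh : h ≠ 0) (hg : HasNormalForm h g) (heq : ∀ c, g 0 c = g h c) :
    ∃ U W : Polynomial (Polynomial ℂ), ∀ l c, g l c =
      U.evalEval c (l ^ 2 - h * l) +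
        W.evalEval c (l ^ 2 - h * l) * ((l ^ 2 - h * l) * l) := by
  obtain ⟨U, V, hUV⟩ := hg
  have hV : Polynomial.X ∣ V := by
    rw [Polynomial.X_dvd_iff]
    refine Polynomial.funext fun c => ?_
    have h1 := heq c
    rw [hUV, hUV] at h1
    -- Both values of `λ` give `k = 0`, so the contributions of `U` cancel.
    have h2 : V.evalEval c 0 * h = 0 := by
      simpa [show h ^ 2 - h * h = 0 by ring] using h1
    simpa [Polynomial.evalEval, ← Polynomial.coeff_zero_eq_eval_zero] using
      (mul_eq_zero.1 h2).resolve_right hh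
  obtain ⟨W, rfl⟩ := hV
  refine ⟨U, W, fun l c => ?_⟩
  rw [hUV, Polynomial.evalEval_mul, Polynomial.evalEval_X]
  ring

end HasNormalForm

theorem exists_mvPolynomial_evalEval {n : ℕ} (U : Polynomial (Polynomial ℂ))
    (P K : MvPolynomial (Fin n) ℂ) :
    ∃ Q : MvPolynomial (Fin n) ℂ, ∀ c,
      MvPolynomial.eval c Q = U.evalEval (MvPolynomial.eval c P) (MvPolynomial.eval c K) := by
  refine ⟨U.eval₂ (Polynomial.aeval P).toRingHom K, fun c => ?_⟩
  have hcomp : (MvPolynomial.eval c).comp (Polynomial.aeval P).toRingHom =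
      Polynomial.evalRingHom (MvPolynomial.eval c P) := by
    refine Polynomial.ringHom_ext (fun a => by simp) (by simp)
  rw [Polynomial.hom_eval₂, hcomp, Polynomial.evalEval, ← Polynomial.coe_evalRingHom,
    Polynomial.eval, Polynomial.hom_eval₂]
  simp

/-! ### The coefficients `a_n` and the relations among them. -/

variable (h : ℝ)

/-- The coefficients of `Ψ_μ(f ξ + λ f') = ∑_n a_n f^(n) ξ^(1-n)`. -/
def densityCoeff (lam μ : ℂ) : ℕ → ℂ
  | 0 => 1
  | n + 1 => Ring.choose μ (n + 1) * (h : ℂ) ^ (n + 1) + lam * (Ring.choose μ n * (h : ℂ) ^ n)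

theorem choose_two (μ : ℂ) : Ring.choose μ 2 = μ * (μ - 1) / 2 := by
  simp [← prod_sub_div_factorial, Finset.prod_range_succ]

theorem choose_three (μ : ℂ) : Ring.choose μ 3 = μ * (μ - 1) * (μ - 2) / 6 := by
  simp [← prod_sub_div_factorial, Finset.prod_range_succ, Nat.factorial]

theorem densityCoeff_one (lam μ : ℂ) : densityCoeff h lam μ 1 = lam + h * μ := by
  simp [densityCoeff]; ring

theorem densityCoeff_two (lam μ : ℂ) :
    densityCoeff h lam μ 2 = h ^ 2 * (μ * (μ - 1) / 2) + lam * μ * h := by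
  simp [densityCoeff, choose_two]; ring

theorem densityCoeff_three (lam μ : ℂ) :
    densityCoeff h lam μ 3 =
      h ^ 3 * (μ * (μ - 1) * (μ - 2) / 6) + lam * h ^ 2 * (μ * (μ - 1) / 2) := by
  simp [densityCoeff, choose_three, choose_two]; ring

/-- The identity `Ψ_μ(f ξ + h f') = Ψ_(μ+1)(f ξ)`, which comes from `f ξ + h f' = ξ ∘_h f`. -/
theorem densityCoeff_self (μ : ℂ) (n : ℕ) :
    densityCoeff h h μ n = densityCoeff h 0 (μ + 1) n := by
  cases n with
  | zero => rfl
  | succ n =>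
    simp only [densityCoeff, Ring.choose_succ_succ, zero_mul, add_zero]
    ring

/-- Every `a_n` is a polynomial in `a_1`, `a_2`, `a_3`. -/
theorem exists_densityCoeff_eq_eval (hh : h ≠ 0) (n : ℕ) :
    ∃ Q : MvPolynomial (Fin 3) ℂ, ∀ lam μ, densityCoeff h lam μ n =
      MvPolynomial.eval
        ![densityCoeff h lam μ 1, densityCoeff h lam μ 2, densityCoeff h lam μ 3] Q := by
  have hc : (h : ℂ) ≠ 0 := Complex.ofReal_ne_zero.2 hh
  -- Here `c` plays the role of `a_1 = λ + h μ`, so that `μ = (c - λ)/h`.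
  have hμ : HasNormalForm h fun l c => (c + (-1) * l) * (h : ℂ)⁻¹ :=
    (HasNormalForm.snd.add ((HasNormalForm.const _).mul HasNormalForm.fst)).mul
      (HasNormalForm.const _)
  have hform : HasNormalForm h fun l c => densityCoeff h l ((c + (-1) * l) * (h : ℂ)⁻¹) n := by
    cases n with
    | zero => exact HasNormalForm.const 1
    | succ n =>
      exact ((hμ.choose (n + 1)).mul (.const _)).add (.mul .fst ((hμ.choose n).mul (.const _)))
  -- The points `(0, c/h)` and `(h, c/h - 1)` share the value `a_1 = c` and are identified by
  -- `densityCoeff_self`.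
  obtain ⟨U, W, hUW⟩ := hform.exists_of_apply_eq hc fun c => by
    rw [densityCoeff_self]
    congr 1
    field_simp
    ring
  -- `K` and `L` express `k = λ² - h λ` and `k λ` through `a_1`, `a_2`, `a_3`, although `λ` itself
  -- is not a polynomial in them.
  let K : MvPolynomial (Fin 3) ℂ :=
    .X 0 ^ 2 - .C (h : ℂ) * .X 0 - .C 2 * .X 1
  let L : MvPolynomial (Fin 3) ℂ :=
    .C 3 * .X 2 - .X 1 * (.X 0 - .C (2 * (h : ℂ))) + K * .X 0
  obtain ⟨QU, hQU⟩ := exists_mvPolynomial_evalEval U (.X 0) K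
  obtain ⟨QW, hQW⟩ := exists_mvPolynomial_evalEval W (.X 0) K
  refine ⟨QU + QW * L, fun lam μ => ?_⟩
  have key := hUW lam (lam + h * μ)
  have h1 : (lam + h * μ + (-1) * lam) * (h : ℂ)⁻¹ = μ := by field_simp; ring
  rw [h1] at key
  set c := ![densityCoeff h lam μ 1, densityCoeff h lam μ 2, densityCoeff h lam μ 3] with hcdef
  have h0 : MvPolynomial.eval c (.X 0) = lam + h * μ := by
    simp [hcdef, densityCoeff_one]
  have hK : MvPolynomial.eval c K = lam ^ 2 - h * lam := by
    simp [K, hcdef, densityCoeff_one, densityCoeff_two]; ring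
  have hL : MvPolynomial.eval c L = (lam ^ 2 - h * lam) * lam := by
    simp only [L, map_add, map_mul, hK, map_sub]
    simp [hcdef, densityCoeff_one, densityCoeff_two, densityCoeff_three]; ring
  rw [key, map_add, map_mul, hQU, hQW, h0, hK, hL]

/-! ### Linear parts -/

/-- The expansion to first order of a polynomial along a curve through the origin. -/
theorem coeff_aeval_of_coeff_zero {n : ℕ} (γ : Fin n → Polynomial ℂ)
    (hγ : ∀ i, (γ i).coeff 0 = 0) (Q : MvPolynomial (Fin n) ℂ) :
    (MvPolynomial.aeval γ Q).coeff 0 = Q.coeff 0 ∧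
      (MvPolynomial.aeval γ Q).coeff 1 =
        ∑ i, Q.coeff (Finsupp.single i 1) * (γ i).coeff 1 := by
  induction Q using MvPolynomial.induction_on with
  | C a => simp [MvPolynomial.coeff_C, Polynomial.coeff_C, eq_comm (a := (0 : Fin n →₀ ℕ))]
  | add p q hp hq =>
    simp [hp.1, hp.2, hq.1, hq.2, add_mul, Finset.sum_add_distrib]
  | mul_X p i hp =>
    refine ⟨by simp [Polynomial.mul_coeff_zero, hγ, MvPolynomial.coeff_mul_X'], ?_⟩
    rw [map_mul, MvPolynomial.aeval_X, Polynomial.coeff_mul,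
      Finset.Nat.sum_antidiagonal_eq_sum_range_succ_mk, Finset.sum_range_succ,
      Finset.sum_range_one, Finset.sum_eq_single i]
    · simp [MvPolynomial.coeff_mul_X', hp.1, hγ]
    · intro j _ hji
      rw [MvPolynomial.coeff_mul_X', if_neg (by simpa using hji.symm), zero_mul]
    · simp

theorem eval_aeval {n : ℕ} (γ : Fin n → Polynomial ℂ) (Q : MvPolynomial (Fin n) ℂ) (t : ℂ) :
    (MvPolynomial.aeval γ Q).eval t = MvPolynomial.eval (fun i => (γ i).eval t) Q := by
  rw [← Polynomial.coe_evalRingHom, MvPolynomial.map_aeval]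
  have hC : (Polynomial.evalRingHom t).comp (algebraMap ℂ (Polynomial ℂ)) = RingHom.id ℂ :=
    RingHom.ext fun a => by simp
  rw [hC]
  rfl

/-- The first order terms of a polynomial that expresses `a_n` through `a_1`, `a_2`, `a_3`. -/
theorem coeff_of_densityCoeff_eq_eval (hh : h ≠ 0) (n : ℕ) (Q : MvPolynomial (Fin 3) ℂ)
    (hQ : ∀ lam μ, densityCoeff h lam μ (n + 4) = MvPolynomial.eval
      ![densityCoeff h lam μ 1, densityCoeff h lam μ 2, densityCoeff h lam μ 3] Q) :
    Q.coeff 0 = 0 ∧ Q.coeff (Finsupp.single 0 1) = 0 ∧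
    Q.coeff (Finsupp.single 1 1) =
      (-1) ^ (n + 3) * (2 * ((n : ℂ) + 1) / ((n : ℂ) + 4)) * (h : ℂ) ^ (n + 2) ∧
    Q.coeff (Finsupp.single 2 1) =
      (-1) ^ (n + 3) * (3 * ((n : ℂ) + 2) / ((n : ℂ) + 4)) * (h : ℂ) ^ (n + 1) := by
  -- Three lines in the parameter plane yield curves through the origin with tangents `(1, 0, 0)`,
  -- `(h, -h²/2, h³/3)` and `(1, -h, h²)`, independent because `h ≠ 0`. The third is parametrised by
  -- `λ = h + t`, so that it meets the second preimage `(h, -1)` of the origin at `t = 0`.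
  have hc : (h : ℂ) ≠ 0 := Complex.ofReal_ne_zero.2 hh
  have hn : (n : ℂ) + 4 ≠ 0 := by exact_mod_cast (by omega : n + 4 ≠ 0)
  -- the line `μ = 0`
  let γ₁ : Fin 3 → Polynomial ℂ := ![.X, 0, 0]
  have e₁ : MvPolynomial.aeval γ₁ Q = 0 := by
    refine Polynomial.funext fun t => ?_
    rw [eval_aeval, Polynomial.eval_zero]
    have := hQ t 0
    simp only [densityCoeff_one, densityCoeff_two, densityCoeff_three] at this
    rw [show densityCoeff h t 0 (n + 4) = 0 by simp [densityCoeff, Ring.choose_zero_succ]] at this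
    rw [this]
    congr 2
    ext i; fin_cases i <;> simp [γ₁]
  -- the line `λ = 0`
  let γ₂ : Fin 3 → Polynomial ℂ :=
    ![.C (h : ℂ) * .X, .C ((h : ℂ) ^ 2 / 2) * (.X * (.X - 1)),
      .C ((h : ℂ) ^ 3 / 6) * (.X * ((.X - 1) * (.X - 2)))]
  have e₂ : MvPolynomial.aeval γ₂ Q =
      .C ((h : ℂ) ^ (n + 4) / ((n + 4).factorial : ℂ)) *
        (.X * ∏ j ∈ Finset.range (n + 3), (.X - .C ((j : ℂ) + 1))) := by
    refine Polynomial.funext fun t => ?_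
    rw [eval_aeval]
    have := hQ 0 t
    simp only [densityCoeff_one, densityCoeff_two, densityCoeff_three] at this
    rw [show densityCoeff h 0 t (n + 4) = (h : ℂ) ^ (n + 4) / ((n + 4).factorial : ℂ) *
        (t * ∏ j ∈ Finset.range (n + 3), (t - ((j : ℂ) + 1))) by
      rw [densityCoeff, zero_mul, add_zero, ← pow_div_factorial_mul_prod,
        Finset.prod_range_succ']
      push_cast
      ring] at this
    simp only [Polynomial.eval_mul, Polynomial.eval_C, Polynomial.eval_X, Polynomial.eval_prod,
      Polynomial.eval_sub]
    rw [this]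
    congr 2
    ext i; fin_cases i <;> simp [γ₂] <;> ring
  -- the line `μ = -1`
  let γ₃ : Fin 3 → Polynomial ℂ :=
    ![.X, .C (-(h : ℂ)) * .X, .C ((h : ℂ) ^ 2) * .X]
  have hneg : ∀ m : ℕ, Ring.choose (-1 : ℂ) m = (-1) ^ m := fun m => by
    induction m with
    | zero => simp
    | succ m ih =>
      have := Ring.choose_succ_succ (-1 : ℂ) m
      rw [neg_add_cancel, Ring.choose_zero_succ, ih] at this
      rw [pow_succ]
      linear_combination -this
  have e₃ : MvPolynomial.aeval γ₃ Q = .C ((-1) ^ (n + 3) * (h : ℂ) ^ (n + 3)) * .X := by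
    refine Polynomial.funext fun t => ?_
    rw [eval_aeval]
    have := hQ (h + t) (-1)
    simp only [densityCoeff_one, densityCoeff_two, densityCoeff_three] at this
    rw [show densityCoeff h (h + t) (-1) (n + 4) = (-1) ^ (n + 3) * (h : ℂ) ^ (n + 3) * t by
      rw [densityCoeff, hneg, hneg]; ring] at this
    simp only [Polynomial.eval_mul, Polynomial.eval_C, Polynomial.eval_X]
    rw [this]
    congr 2
    ext i; fin_cases i <;> simp [γ₃] <;> ring
  obtain ⟨z, l₁⟩ := coeff_aeval_of_coeff_zero γ₁ (fun i => by fin_cases i <;> simp [γ₁]) Q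
  have l₂ := (coeff_aeval_of_coeff_zero γ₂ (fun i => by fin_cases i <;> simp [γ₂]) Q).2
  have l₃ := (coeff_aeval_of_coeff_zero γ₃ (fun i => by fin_cases i <;> simp [γ₃]) Q).2
  -- Against the `(n+4)!` in the denominator this leaves the factor `1/(n+4)`.
  have hprod : (∏ j ∈ Finset.range (n + 3), (Polynomial.X - Polynomial.C ((j : ℂ) + 1))).coeff 0 =
      (-1) ^ (n + 3) * ((n + 3).factorial : ℂ) := by
    rw [Polynomial.coeff_zero_prod, ← Finset.prod_range_add_one_eq_factorial]
    push_cast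
    rw [← Finset.card_range (n + 3), ← Finset.prod_const, Finset.card_range,
      ← Finset.prod_mul_distrib]
    exact Finset.prod_congr rfl fun j _ => by simp
  have s₂ : (γ₂ 1).coeff 1 = -((h : ℂ) ^ 2 / 2) ∧ (γ₂ 2).coeff 1 = (h : ℂ) ^ 3 / 3 := by
    constructor
    · simp [γ₂, Polynomial.coeff_X_mul]
    · simp [γ₂, Polynomial.coeff_X_mul, Polynomial.mul_coeff_zero]
      ring
  have s₃ : (γ₃ 0).coeff 1 = 1 ∧ (γ₃ 1).coeff 1 = -(h : ℂ) ∧ (γ₃ 2).coeff 1 = (h : ℂ) ^ 2 := by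
    refine ⟨?_, ?_, ?_⟩ <;>
      simp only [γ₃, Matrix.cons_val, Polynomial.coeff_C_mul, Polynomial.coeff_X_one, mul_one]
  rw [e₁, Fin.sum_univ_three] at l₁
  rw [e₁] at z
  rw [e₂, Fin.sum_univ_three, s₂.1, s₂.2, Polynomial.coeff_C_mul, Polynomial.coeff_X_mul, hprod,
    Nat.factorial_succ] at l₂
  rw [e₃, Fin.sum_univ_three, s₃.1, s₃.2.1, s₃.2.2, Polynomial.coeff_C_mul,
    Polynomial.coeff_X_one, mul_one, mul_one] at l₃
  simp [γ₁] at z l₁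
  have hfac : ((n + 3).factorial : ℂ) ≠ 0 := by exact_mod_cast (n + 3).factorial_ne_zero
  rw [← l₁, zero_mul, zero_add] at l₂
  rw [← l₁, zero_add] at l₃
  push_cast at l₂
  -- The first curve removes the coefficient of `a_1`; the other two, divided by `h²` and `h`, give
  -- a 2×2 system for the remaining coefficients.
  have l₂' : (-1) ^ (n + 3) * (h : ℂ) ^ (n + 2) / ((n : ℂ) + 4) =
      -Q.coeff (Finsupp.single 1 1) / 2 + Q.coeff (Finsupp.single 2 1) * h / 3 := by
    rw [show (n : ℂ) + 3 + 1 = n + 4 by ring] at l₂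
    field_simp at l₂ ⊢
    refine mul_left_cancel₀ (pow_ne_zero 2 hc) ?_
    linear_combination l₂
  have l₃' : (-1) ^ (n + 3) * (h : ℂ) ^ (n + 2) =
      -Q.coeff (Finsupp.single 1 1) + Q.coeff (Finsupp.single 2 1) * h := by
    refine mul_left_cancel₀ hc ?_
    linear_combination l₃
  refine ⟨z.symm, l₁.symm, ?_, ?_⟩
  · field_simp at l₂' ⊢
    linear_combination l₂' - 2 * ((n : ℂ) + 4) * l₃'
  · field_simp at l₂' ⊢
    refine mul_right_cancel₀ hc ?_
    linear_combination l₂' - 3 * ((n : ℂ) + 4) * l₃'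

theorem two_le_degree_of_mem_support {n : ℕ} {P : MvPolynomial (Fin n) ℂ} (h0 : P.coeff 0 = 0)
    (h1 : ∀ i, P.coeff (Finsupp.single i 1) = 0) {α : Fin n →₀ ℕ} (hα : α ∈ P.support) :
    2 ≤ α.degree := by
  rw [MvPolynomial.mem_support_iff] at hα
  have hne : α ≠ 0 := fun hz => hα (hz ▸ h0)
  obtain ⟨i, hi⟩ := Finsupp.ne_iff.1 hne
  have hle : Finsupp.single i 1 ≤ α :=
    Finsupp.single_le_iff.2 (Nat.one_le_iff_ne_zero.2 hi)
  obtain ⟨β, rfl⟩ := exists_add_of_le hle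
  have hβ : β.degree ≠ 0 := fun hz => by
    rw [Finsupp.degree_eq_zero_iff] at hz
    exact hα (by rw [hz, add_zero, h1])
  rw [map_add, Finsupp.degree_single]
  omega

/-- The terms of higher degree of the deformation: `a_n`, `n ≥ 4`, is the sum of the coefficients
of `θ₂` and `θ₃` with weights `a_2`, `a_3` and of a polynomial in `a_1`, `a_2`, `a_3` without
terms of degree less than `2`. -/
theorem exists_higherTerms (hh : h ≠ 0) (n : ℕ) :
    ∃ R : MvPolynomial (Fin 3) ℂ, (∀ α ∈ R.support, 2 ≤ α.degree) ∧
      ∀ lam μ, densityCoeff h lam μ (n + 4) =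
        densityCoeff h lam μ 2 *
          ((-1) ^ (n + 3) * (2 * ((n : ℂ) + 1) / ((n : ℂ) + 4)) * (h : ℂ) ^ (n + 2)) +
        densityCoeff h lam μ 3 *
          ((-1) ^ (n + 3) * (3 * ((n : ℂ) + 2) / ((n : ℂ) + 4)) * (h : ℂ) ^ (n + 1)) +
        MvPolynomial.eval
          ![densityCoeff h lam μ 1, densityCoeff h lam μ 2, densityCoeff h lam μ 3] R := by
  obtain ⟨Q, hQ⟩ := exists_densityCoeff_eq_eval h hh (n + 4)
  obtain ⟨q, q₀, q₁, q₂⟩ := coeff_of_densityCoeff_eq_eval h hh n Q hQ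
  refine ⟨Q - (.C (Q.coeff (Finsupp.single 1 1)) * .X 1 +
    .C (Q.coeff (Finsupp.single 2 1)) * .X 2), fun α hα => ?_, fun lam μ => ?_⟩
  · refine two_le_degree_of_mem_support ?_ (fun i => ?_) hα
    · simp [q]
    · fin_cases i <;> simp [q₀, MvPolynomial.coeff_X, Finsupp.single_left_inj]
  · rw [map_sub, ← hQ, ← q₁, ← q₂]
    simp
    ring

end

section

/-! ### The infinitesimal deformation and the quartic relation -/

theorem mono_eq_diffSymbol (d : ℤ) (f : SmoothCircle) :
    mono d f = diffSymbol d (Pi.single 0 1) f := by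
  refine PsiD.ext_below d (fun k hk => ?_) (fun k hk => diffSymbol_apply_of_lt hk _ _) fun n => ?_
  · rw [mono_apply, if_neg (by omega)]
  · rw [mono_apply, diffSymbol_apply_sub]
    obtain _ | n := n
    · simp
    · rw [if_neg (by omega), Pi.single_eq_of_ne (by omega), zero_smul]

/-- Brings the terms built from `f'` to the same base `f ξ` as the others, so that symbols can be
compared through their coefficient sequences. -/
theorem diffSymbol_D (d : ℤ) (a : ℕ → ℂ) (f : SmoothCircle) :
    diffSymbol d a (D f) =
      diffSymbol (d + 1) (fun n => if n = 0 then 0 else a (n - 1)) f := by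
  refine PsiD.ext_below (d + 1) (fun k hk => diffSymbol_apply_of_lt (by omega) _ _)
    (fun k hk => diffSymbol_apply_of_lt hk _ _) fun n => ?_
  rw [diffSymbol_apply_sub]
  obtain _ | n := n
  · simp [diffSymbol_apply_of_lt]
  · rw [show d + 1 - ((n + 1 : ℕ) : ℤ) = d - n by push_cast; ring, diffSymbol_apply_sub,
      pow_succ D, Module.End.mul_apply]
    simp

theorem diffSymbol_coeff_add (d : ℤ) (a b : ℕ → ℂ) (f : SmoothCircle) :
    diffSymbol d a f + diffSymbol d b f = diffSymbol d (a + b) f := by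
  refine PsiD.ext_apply fun k => ?_
  simp only [diffSymbol, Submodule.coe_add, Pi.add_apply]
  split_ifs <;> simp [add_smul]

theorem diffSymbol_coeff_smul (d : ℤ) (c : ℂ) (a : ℕ → ℂ) (f : SmoothCircle) :
    c • diffSymbol d a f = diffSymbol d (c • a) f := by
  refine PsiD.ext_apply fun k => ?_
  simp only [diffSymbol, Submodule.coe_smul, Pi.smul_apply]
  split_ifs <;> simp [mul_smul]

variable (h : ℝ)

theorem universalDeformation_eq_densityCoeff (lam μ ν : ℂ) (f : Vect) :
    universalDeformation h lam μ ν f =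
      diffSymbol 1 (densityCoeff h lam μ) f + ν • Psi h μ (mono 0 f) := by
  rw [universalDeformation_eq, Psi_mono, add_right_comm]
  congr 1
  rw [binomialSymbol, binomialSymbol, diffSymbol_D, zero_add, diffSymbol_coeff_smul,
    diffSymbol_coeff_add]
  congr 1
  funext n
  cases n <;> simp [densityCoeff]

/-- On the quartic, `c₁`, `c₂`, `c₃` are the first coefficients of some `Ψ_μ(f ξ + λ f')`. -/
theorem HQuartic.exists_densityCoeff {h : ℝ} (hh : h ≠ 0) {c₁ c₂ c₃ : ℂ}
    (hc : HQuartic h c₁ c₂ c₃) :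
    ∃ lam μ : ℂ, densityCoeff h lam μ 1 = c₁ ∧ densityCoeff h lam μ 2 = c₂ ∧
      densityCoeff h lam μ 3 = c₃ := by
  have hne : (h : ℂ) ≠ 0 := Complex.ofReal_ne_zero.2 hh
  -- The discriminant of the quadratic that `a_1 = c₁` and `a_2 = c₂` impose on `s = h μ`.
  obtain ⟨δ, hδ⟩ := IsAlgClosed.exists_pow_nat_eq ((2 * c₁ - h) ^ 2 - 8 * c₂) two_pos
  -- The second equation is the cubic `a_3 = c₃` reduced modulo the first. The product of its values
  -- at the two roots is four times the quartic, so one root satisfies both.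
  obtain ⟨s, hs, hs'⟩ : ∃ s : ℂ, s ^ 2 + (h - 2 * c₁) * s + 2 * c₂ = 0 ∧
      6 * c₃ - 2 * c₂ * (c₁ - 2 * h) + 2 * (c₁ ^ 2 - h * c₁ - 2 * c₂) * s = 0 := by
    have hprod : (6 * c₃ - 2 * c₂ * (c₁ - 2 * h) +
          2 * (c₁ ^ 2 - h * c₁ - 2 * c₂) * ((2 * c₁ - h + δ) / 2)) *
        (6 * c₃ - 2 * c₂ * (c₁ - 2 * h) +
          2 * (c₁ ^ 2 - h * c₁ - 2 * c₂) * ((2 * c₁ - h - δ) / 2)) = 0 := by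
      rw [HQuartic] at hc
      linear_combination 4 * hc - (c₁ ^ 2 - h * c₁ - 2 * c₂) ^ 2 * hδ
    rcases mul_eq_zero.1 hprod with hz | hz
    · exact ⟨_, by linear_combination hδ / 4, hz⟩
    · exact ⟨_, by linear_combination hδ / 4, hz⟩
  have hμ : (h : ℂ) * (s / h) = s := mul_div_cancel₀ s hne
  refine ⟨c₁ - s, s / h, ?_, ?_, ?_⟩
  · rw [densityCoeff_one, hμ]; ring
  · rw [densityCoeff_two]
    have h2 : (h : ℂ) ^ 2 * (s / h * (s / h - 1) / 2) + (c₁ - s) * (s / h) * h =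
        s * (s - h) / 2 + (c₁ - s) * s := by field_simp
    rw [h2]
    linear_combination -hs / 2
  · rw [densityCoeff_three]
    have h3 : (h : ℂ) ^ 3 * (s / h * (s / h - 1) * (s / h - 2) / 6) +
        (c₁ - s) * h ^ 2 * (s / h * (s / h - 1) / 2) =
        s * (s - h) * (s - 2 * h) / 6 + (c₁ - s) * (s * (s - h) / 2) := by field_simp
    rw [h3]
    linear_combination (-2 * s + 2 * h - c₁) / 6 * hs - hs' / 6

/-- The coefficients of the infinitesimal deformation with `c₀ = 0`. -/
def infinitesimalCoeff (c₁ c₂ c₃ : ℂ) : ℕ → ℂ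
  | 0 => 1
  | 1 => c₁
  | 2 => c₂
  | 3 => c₃
  | n + 4 =>
    c₂ * ((-1) ^ (n + 3) * (2 * ((n : ℂ) + 1) / ((n : ℂ) + 4)) * (h : ℂ) ^ (n + 2)) +
      c₃ * ((-1) ^ (n + 3) * (3 * ((n : ℂ) + 2) / ((n : ℂ) + 4)) * (h : ℂ) ^ (n + 1))

theorem infinitesimalDeformation_eq (c₀ c₁ c₂ c₃ : ℂ) (f : Vect) :
    infinitesimalDeformation h c₀ c₁ c₂ c₃ f =
      diffSymbol 1 (infinitesimalCoeff h c₁ c₂ c₃) f + c₀ • mono 0 f := by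
  have key : standardEmbedding f + c₁ • theta1 f + c₂ • theta2 h f + c₃ • theta3 h f =
      diffSymbol 1 (infinitesimalCoeff h c₁ c₂ c₃) f := by
    rw [standardEmbedding, theta1, theta2, theta3, mono_eq_diffSymbol, mono_eq_diffSymbol,
      diffSymbol_D, diffSymbol_D, zero_add]
    simp only [diffSymbol_coeff_smul, diffSymbol_coeff_add]
    congr 1
    funext n
    -- At `n = 2` and `n = 3` the normalisations of `θ₂` and `θ₃` appear: their leading coefficients
    -- are 1, and the factor `n - 3` removes `f''' ξ⁻²` from `θ₂`.
    match n with
    | 0 => simp [infinitesimalCoeff]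
    | 1 => simp [infinitesimalCoeff]
    | 2 => simp [infinitesimalCoeff]; norm_num
    | 3 => simp [infinitesimalCoeff]; norm_num
    | n + 4 =>
      have hn : (n : ℂ) + 4 ≠ 0 := by exact_mod_cast (by omega : n + 4 ≠ 0)
      have hn' : (n : ℂ) + 3 + 1 ≠ 0 := by exact_mod_cast (by omega : n + 3 + 1 ≠ 0)
      simp [infinitesimalCoeff]
      field_simp
      ring
  rw [infinitesimalDeformation, theta0, ← key]
  abel

theorem exists_universalDeformation_eq (hh : h ≠ 0) :
    ∃ R : ℕ → MvPolynomial (Fin 3) ℂ,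
      (∀ n, n < 4 → R n = 0) ∧
      (∀ n, ∀ α ∈ (R n).support, 2 ≤ α.degree) ∧
      ∀ c₀ c₁ c₂ c₃ : ℂ, HQuartic h c₁ c₂ c₃ →
        ∃ lam μ ν : ℂ, ∀ f : Vect,
          universalDeformation h lam μ ν f =
            infinitesimalDeformation h c₀ c₁ c₂ c₃ f
              + diffSymbol 1 (fun n => MvPolynomial.eval ![c₁, c₂, c₃] (R n)) f
              + ν • (Psi h μ (mono 0 f) - mono 0 f) := by
  choose R hR hRcoeff using exists_higherTerms h hh
  refine ⟨fun n => if n < 4 then 0 else R (n - 4), fun n hn => if_pos hn, fun n α hα => ?_,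
    fun c₀ c₁ c₂ c₃ hc => ?_⟩
  · beta_reduce at hα
    split_ifs at hα with hn
    · simp at hα
    · exact hR _ α hα
  obtain ⟨lam, μ, e₁, e₂, e₃⟩ := hc.exists_densityCoeff hh
  -- With `ν = c₀` the term `c₀ θ₀` is matched exactly, and the rest of `ν Ψ_μ(f)` is the stated
  -- correction.
  refine ⟨lam, μ, c₀, fun f => ?_⟩
  have key : densityCoeff h lam μ = infinitesimalCoeff h c₁ c₂ c₃ +
      fun n => MvPolynomial.eval ![c₁, c₂, c₃] (if n < 4 then 0 else R (n - 4)) := by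
    funext n
    match n with
    | 0 => simp [infinitesimalCoeff, densityCoeff]
    | 1 => simp [infinitesimalCoeff, e₁]
    | 2 => simp [infinitesimalCoeff, e₂]
    | 3 => simp [infinitesimalCoeff, e₃]
    | n + 4 =>
      rw [hRcoeff, e₁, e₂, e₃]
      simp [infinitesimalCoeff]
  rw [universalDeformation_eq_densityCoeff, infinitesimalDeformation_eq, key,
    ← diffSymbol_coeff_add]
  module

end

end PsiDO

end

theorem lemma8p1 (h : ℝ) (h_pos : 0 < h) (h_le_one : h ≤ 1) :
    -- the universal family is a genuine polynomial deformation in its three parameters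
    IsPolynomialDeformation h
      (fun p : Fin 3 → ℂ => universalDeformation h (p 0) (p 1) (p 2)) ∧
    -- its infinitesimal parts exhaust the infinitesimal deformations on the quartic
    ∃ R : ℕ → MvPolynomial (Fin 3) ℂ,
      (∀ n, n < 4 → R n = 0) ∧
      (∀ n, ∀ α ∈ (R n).support, 2 ≤ α.degree) ∧
      ∀ c₀ c₁ c₂ c₃ : ℂ, HQuartic h c₁ c₂ c₃ →
        ∃ lam μ ν : ℂ, ∀ f : Vect,
          universalDeformation h lam μ ν f =
            infinitesimalDeformation h c₀ c₁ c₂ c₃ f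
              + diffSymbol 1 (fun n => MvPolynomial.eval ![c₁, c₂, c₃] (R n)) f
              + ν • (Psi h μ (mono 0 f) - mono 0 f) :=
  ⟨isPolynomialDeformation_universalDeformation h h_pos.ne',
    exists_universalDeformation_eq h h_pos.ne'⟩
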